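/- Let $E$ (edges) and $I$ (commodities) be finite sets, let $1<p<\infty$, and for each $e\in E$ let $\nu_e>0$ (capacity) and $c^0_e>0$ (free-flow travel time) be given. Let $\mathcal R$ be the set of non-negative functions in $L^p_{\mathrm{loc}}(\mathbb R)$ (up to equality almost everywhere) that vanish for negative times, and for $T\in\mathbb R_{\ge 0}$ let $\mathcal R_T\subseteq L^p(\mathbb R)$ be the subset of those that vanish outside $[0,T]$. For a flow $f=(f^+,f^-)\in\mathcal R^{E\times I\times\{+,-\}}$, $e\in E$ and $\theta\in\mathbb R$ put $$X_e(\theta,f)=\int_0^\theta \sum_{i\in I} f^+_{e,i}\,\mathrm d\lambda-\int_0^\theta \sum_{i\in I} f^-_{e,i}\,\mathrm d\lambda,\qquad c_e(\theta,f)=c^0_e+\frac{X_e(\theta,f)}{\nu_e},\qquad \tau_e(\theta,f)=\theta+c_e(\theta,f).$$ The flow $f$ respects the travel times if $\int_0^\theta f^+_{e,i}\,\mathrm d\lambda=\int_0^{\tau_e(\theta,f)} f^-_{e,i}\,\mathrm d\lambda$ for all $e\in E$, $i\in I$, $\theta\in\mathbb R$. Then there is a unique operator $\Phi:\mathcal R^{E\times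 I}\to\mathcal R^{E\times I}$ such that $(f^+,\Phi(f^+))$ respects the travel times for every $f^+\in\mathcal R^{E\times I}$ (the edge loading operator induced by the affine-linear volume-delay functions), and for every $T\in\mathbb R_{\ge 0}$ the following hold. 1. The map $\Phi_T:\mathcal R_T^{E\times I}\to\mathcal R_T^{E\times I}$, $f^+\mapsto \mathbf 1_{[0,T]}\cdot\Phi(f^+)$, is sequentially weak-weak continuous: if $f^{n,+}\to f^+$ weakly in $L^p(\mathbb R)^{E\times I}$, with all members and the limit in $\mathcal R_T^{E\times I}$, then $\Phi_T(f^{n,+})\to\Phi_T(f^+)$ weakly. 2. For every $e\in E$, the map $f\mapsto c_e(\,\cdot\,,f)$ is sequentially weak-strong continuous from $\mathcal R_T^{E\times I\times\{+,-\}}$ to $C([0,T],\mathbb R)$: if $f^n\to f$ weakly in $L^p(\mathbb R)^{E\times I\times\{+,-\}}$, with all members and the limit in $\mathcal R_T^{E\times I\times\{+,-\}}$, then $c_e(\,\cdot\,,f^n)\to c_e(\,\cdot\,,f)$ uniformly on $[0,T]$. Moreover, $c_e(\theta,(f^+,\Phi_T(f^+)))\ge 0$ for all $f^+\in\mathcal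 R_T^{E\times I}$ and $\theta\in[0,T]$. -/

import Mathlib

open MeasureTheory Filter Topology Set
open scoped ENNReal

noncomputable section

/-- Rate functions: (a.e.-classes of) non-negative, locally `p`-integrable functions on `ℝ` that
vanish for negative times. -/
def Rate (p : ℝ≥0∞) : Type :=
  {f : ℝ →ₘ[(volume : Measure ℝ)] ℝ //
    (∀ᵐ θ : ℝ, 0 ≤ f θ) ∧
    (∀ᵐ θ : ℝ, θ < 0 → f θ = 0) ∧
    ∀ K : Set ℝ, IsCompact K → MemLp f p (volume.restrict K)}

instance (p : ℝ≥0∞) : CoeFun (Rate p) (fun _ => ℝ → ℝ) := ⟨fun f => f.1⟩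

/-- Rate functions that vanish outside `[0, T]`. -/
def RateUpTo (p : ℝ≥0∞) (T : ℝ) : Type :=
  {f : Rate p // ∀ᵐ θ : ℝ, θ ∉ Icc (0 : ℝ) T → f θ = 0}

theorem RateUpTo.memLp {p : ℝ≥0∞} {T : ℝ} (f : RateUpTo p T) : MemLp f.1 p volume := by
  have h1 : MemLp ((Icc (0 : ℝ) T).indicator f.1) p volume :=
    (memLp_indicator_iff_restrict measurableSet_Icc).2 (f.1.2.2.2 _ isCompact_Icc)
  refine h1.ae_eq ?_
  filter_upwards [f.2] with θ hθ
  by_cases h : θ ∈ Icc (0 : ℝ) T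
  · simp [h]
  · rw [indicator_of_notMem h, hθ h]

/-- The inclusion of the rate functions vanishing outside `[0, T]` into `L^p(ℝ)`. -/
def RateUpTo.toLp {p : ℝ≥0∞} {T : ℝ} (f : RateUpTo p T) : Lp ℝ p (volume : Measure ℝ) :=
  ⟨f.1.1, Lp.mem_Lp_iff_memLp.2 f.memLp⟩

theorem Rate.memLp_indicator {p : ℝ≥0∞} (f : Rate p) (T : ℝ) :
    MemLp ((Icc (0 : ℝ) T).indicator f) p volume :=
  (memLp_indicator_iff_restrict measurableSet_Icc).2 (f.2.2.2 _ isCompact_Icc)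

/-- The truncation `1_{[0,T]} · f` of a rate function. -/
def Rate.truncate {p : ℝ≥0∞} (T : ℝ) (f : Rate p) : RateUpTo p T :=
  ⟨⟨AEEqFun.mk ((Icc (0 : ℝ) T).indicator f) (f.memLp_indicator T).1, by
      refine ⟨?_, ?_, fun K _ => ?_⟩
      · filter_upwards [AEEqFun.coeFn_mk _ (f.memLp_indicator T).1, f.2.1] with θ h h0
        rw [h]
        exact indicator_apply_nonneg fun _ => h0
      · filter_upwards [AEEqFun.coeFn_mk _ (f.memLp_indicator T).1] with θ h hneg
        rw [h, indicator_of_notMem fun hm => absurd hm.1 (not_le.2 hneg)]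
      · exact ((f.memLp_indicator T).ae_eq (AEEqFun.coeFn_mk _ _).symm).restrict K⟩, by
    filter_upwards [AEEqFun.coeFn_mk _ (f.memLp_indicator T).1] with θ h hout
    exact h.trans (indicator_of_notMem hout _)⟩

/-- Vectors of edge inflow rates, or of edge outflow rates. -/
abbrev RateVec (p : ℝ≥0∞) (E I : Type*) := E × I → Rate p

/-- A dynamic flow `(f⁺, f⁻)`: edge inflow rates and edge outflow rates. -/
abbrev EdgeFlow (p : ℝ≥0∞) (E I : Type*) := RateVec p E I × RateVec p E I

/-- Rate vectors whose entries vanish outside `[0, T]`. -/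
abbrev RateVecUpTo (p : ℝ≥0∞) (T : ℝ) (E I : Type*) := E × I → RateUpTo p T

/-- Flows whose inflow and outflow rates vanish outside `[0, T]`. -/
abbrev FlowUpTo (p : ℝ≥0∞) (T : ℝ) (E I : Type*) :=
  RateVecUpTo p T E I × RateVecUpTo p T E I

def RateVecUpTo.toRateVec {p : ℝ≥0∞} {T : ℝ} {E I : Type*} (g : RateVecUpTo p T E I) :
    RateVec p E I := fun a => (g a).1

def FlowUpTo.toFlow {p : ℝ≥0∞} {T : ℝ} {E I : Type*} (f : FlowUpTo p T E I) : EdgeFlow p E I :=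
  (RateVecUpTo.toRateVec f.1, RateVecUpTo.toRateVec f.2)

/-! ### Affine-linear volume-delay dynamics -/

/-- The flow volume `X_e(θ, f) = ∫_0^θ f_e⁺ - ∫_0^θ f_e⁻`, where `f_e^±` are the aggregate rates. -/
def edgeVolume {p : ℝ≥0∞} {E I : Type*} [Fintype I] (f : EdgeFlow p E I) (e : E) (θ : ℝ) : ℝ :=
  (∫ s in (0 : ℝ)..θ, ∑ i, f.1 (e, i) s) - ∫ s in (0 : ℝ)..θ, ∑ i, f.2 (e, i) s

/-- The travel time `c_e(θ, f) = c⁰_e + X_e(θ, f) / ν_e`. -/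
def travelTime {p : ℝ≥0∞} {E I : Type*} [Fintype I] (ν c₀ : E → ℝ) (f : EdgeFlow p E I) (e : E)
    (θ : ℝ) : ℝ :=
  c₀ e + edgeVolume f e θ / ν e

/-- The exit time `τ_e(θ, f) = θ + c_e(θ, f)`. -/
def exitTime {p : ℝ≥0∞} {E I : Type*} [Fintype I] (ν c₀ : E → ℝ) (f : EdgeFlow p E I) (e : E)
    (θ : ℝ) : ℝ :=
  θ + travelTime ν c₀ f e θ

/-- The flow `f` respects the affine-linear volume-delay travel times (for all times). -/
def RespectsTravelTimes {p : ℝ≥0∞} {E I : Type*} [Fintype I] (ν c₀ : E → ℝ)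
    (f : EdgeFlow p E I) : Prop :=
  ∀ (e : E) (i : I) (θ : ℝ),
    ∫ s in (0 : ℝ)..θ, f.1 (e, i) s = ∫ s in (0 : ℝ)..exitTime ν c₀ f e θ, f.2 (e, i) s

/-- Edge loading operators map edge inflow rates to edge outflow rates. -/
abbrev EdgeLoadingOperator (p : ℝ≥0∞) (E I : Type*) := RateVec p E I → RateVec p E I

/-- `Φ` is the edge loading operator induced by the affine-linear volume-delay functions with
capacities `ν` and free-flow travel times `c₀`. -/
def IsVolumeDelayLoading {p : ℝ≥0∞} {E I : Type*} [Fintype I] (ν c₀ : E → ℝ)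
    (Φ : EdgeLoadingOperator p E I) : Prop :=
  ∀ f : RateVec p E I, RespectsTravelTimes ν c₀ (f, Φ f)

/-- The restricted operator `Φ_T : f⁺ ↦ 1_{[0,T]} · Φ(f⁺)`. -/
def EdgeLoadingOperator.restrict {p : ℝ≥0∞} {E I : Type*} (Φ : EdgeLoadingOperator p E I) (T : ℝ)
    (f : RateVecUpTo p T E I) : RateVecUpTo p T E I :=
  fun a => (Φ (RateVecUpTo.toRateVec f) a).truncate T

theorem Rate.intervalIntegrable {p : ℝ≥0∞} (hp : 1 ≤ p) (f : Rate p) (a b : ℝ) :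
    IntervalIntegrable f volume a b := by
  rw [intervalIntegrable_iff]
  have : IsFiniteMeasure ((volume : Measure ℝ).restrict (uIcc a b)) :=
    ⟨by simp⟩
  have h : IntegrableOn f (uIcc a b) volume := (f.2.2.2 _ isCompact_uIcc).integrable hp
  exact h.mono_set uIoc_subset_uIcc

theorem continuous_travelTime {p : ℝ≥0∞} (hp : 1 ≤ p) {E I : Type*} [Fintype I] (ν c₀ : E → ℝ)
    (f : EdgeFlow p E I) (e : E) : Continuous (travelTime ν c₀ f e) := by
  have h : ∀ g : RateVec p E I, Continuous fun θ : ℝ => ∫ s in (0 : ℝ)..θ, ∑ i, g (e, i) s := by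
    intro g
    refine intervalIntegral.continuous_primitive (fun a b => ?_) 0
    have hs := IntervalIntegrable.sum Finset.univ (μ := volume) (a := a) (b := b)
      (f := fun i => (g (e, i) : ℝ → ℝ)) fun i _ => (g (e, i)).intervalIntegrable hp a b
    have he : (fun s => ∑ i, g (e, i) s) = ∑ i, (g (e, i) : ℝ → ℝ) := by
      funext s
      simp
    rw [he]
    exact hs
  unfold travelTime edgeVolume
  exact continuous_const.add (((h f.1).sub (h f.2)).div_const _)

/-- The travel time function `c_e(·, f)` as an element of `C([0, T])`. -/
def travelTimeOn {p : ℝ≥0∞} [Fact (1 ≤ p)] {E I : Type*} [Fintype I] (ν c₀ : E → ℝ) (T : ℝ)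
    (e : E) (f : FlowUpTo p T E I) : C(Icc (0 : ℝ) T, ℝ) :=
  ⟨fun θ => travelTime ν c₀ (FlowUpTo.toFlow f) e θ,
    (continuous_travelTime Fact.out ν c₀ _ e).comp continuous_subtype_val⟩

/-! ### Sequential continuity with respect to weak convergence -/

/-- The sequence `x` converges to `y` in the weak topology of `X`. -/
def WeaklyConverges {X : Type*} [NormedAddCommGroup X] [NormedSpace ℝ X] (x : ℕ → X) (y : X) :
    Prop :=
  Tendsto (fun n => toWeakSpace ℝ X (x n)) atTop (𝓝 (toWeakSpace ℝ X y))

/-- The inclusion of the rate vectors vanishing outside `[0, T]` into `L^p(ℝ)^{E × I}`. -/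
def RateVecUpTo.toLp {p : ℝ≥0∞} {T : ℝ} {E I : Type*} (g : RateVecUpTo p T E I) :
    E × I → Lp ℝ p (volume : Measure ℝ) :=
  fun a => (g a).toLp

/-- The inclusion of the flows vanishing outside `[0, T]` into `L^p(ℝ)^{E × I × {+,-}}`. -/
def FlowUpTo.toLp {p : ℝ≥0∞} {T : ℝ} {E I : Type*} (f : FlowUpTo p T E I) :
    (E × I → Lp ℝ p (volume : Measure ℝ)) × (E × I → Lp ℝ p (volume : Measure ℝ)) :=
  (RateVecUpTo.toLp f.1, RateVecUpTo.toLp f.2)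

/-- Sequential weak-weak continuity of a self-map of the rate vectors vanishing outside `[0, T]`. -/
def SeqWeakWeakContinuous {p : ℝ≥0∞} [Fact (1 ≤ p)] {T : ℝ} {E I : Type*} [Fintype E] [Fintype I]
    (Ψ : RateVecUpTo p T E I → RateVecUpTo p T E I) : Prop :=
  ∀ (g : ℕ → RateVecUpTo p T E I) (h : RateVecUpTo p T E I),
    WeaklyConverges (fun n => RateVecUpTo.toLp (g n)) (RateVecUpTo.toLp h) →
    WeaklyConverges (fun n => RateVecUpTo.toLp (Ψ (g n))) (RateVecUpTo.toLp (Ψ h))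

/-- Sequential weak-strong continuity of a map from the flows vanishing outside `[0, T]` to a
topological space (with its given, strong, topology). -/
def SeqWeakStrongContinuous {p : ℝ≥0∞} [Fact (1 ≤ p)] {T : ℝ} {E I : Type*} [Fintype E]
    [Fintype I] {Y : Type*} [TopologicalSpace Y] (C : FlowUpTo p T E I → Y) : Prop :=
  ∀ (f : ℕ → FlowUpTo p T E I) (g : FlowUpTo p T E I),
    WeaklyConverges (fun n => FlowUpTo.toLp (f n)) (FlowUpTo.toLp g) →
    Tendsto (fun n => C (f n)) atTop (𝓝 (C g))

end

/-!
Everything is carried by the primitives `F`, `G` of the inflow and outflow rates of a single edge.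
In terms of them the flow respects the travel times iff `F i = G i ∘ τ` for all commodities `i`,
where `τ(θ) = θ + c + (∑ F - ∑ G)(θ) / ν` (`IsCumulativeLoading`).

*Exit times.* Such a flow satisfies `∑ G ≤ ∑ F` (`outflow_le_inflow`), hence `τ(θ) ≥ θ + c`. In
particular travel times are non-negative, and the outflow up to time `t` is determined by data up
to time `t - c`.

*Existence* (`exists_isCumulativeLoading`). If `∑ G` is `ν`-Lipschitz, then
`(∑ F)(y) - (∑ F)(x) ≤ ν (τ(y) - τ(x))` for `x ≤ y`, so that `∑ F` factors through `τ` as a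
`ν`-Lipschitz function. This defines a map on the monotone, `ν`-Lipschitz functions between `0` and
`∑ F`, which is increasing in `∑ G`. The Knaster-Tarski argument gives a fixed point, and the outflow
of each commodity is obtained from it by the same factorization. Being Lipschitz, the outflows
have densities, which are bounded by `ν`.

*Stability and uniqueness* (`IsCumulativeLoading.tendsto`). If the cumulative inflows converge
pointwise, so do the cumulative outflows, by induction over the intervals `(-∞, k c]`. Constant
sequences give uniqueness.

*Weak convergence.* Weak convergence of the rates implies pointwise convergence of the primitives.
As these are monotone with continuous limits, the convergence is locally uniform, which is the
weak-strong continuity of the travel times. Conversely, for outflow rates, which are bounded by `ν`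
and supported in `[0, T]`, pointwise convergence of the primitives implies weak convergence in
`L^p` (`tendsto_apply_of_tendsto_primitive`): on such functions every functional is integration
against an integrable function, by the Radon-Nikodym theorem, so that no description of the dual
of `L^p` is needed.
-/

/-! ### Cumulative flows -/

/-- A cumulative flow: the primitive of a rate function that is non-negative and vanishes for
negative times. -/
structure IsCumulative (F : ℝ → ℝ) : Prop where
  monotone : Monotone F
  continuous : Continuous F
  eq_zero : ∀ t ≤ 0, F t = 0

theorem IsCumulative.nonneg {F : ℝ → ℝ} (hF : IsCumulative F) (t : ℝ) : 0 ≤ F t := by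
  rcases le_total t 0 with h | h
  · exact (hF.eq_zero t h).ge
  · exact (hF.eq_zero 0 le_rfl).ge.trans (hF.monotone h)

theorem IsCumulative.sum {I : Type*} [Fintype I] {F : I → ℝ → ℝ} (hF : ∀ i, IsCumulative (F i)) :
    IsCumulative fun t => ∑ i, F i t where
  monotone := fun _ _ h => Finset.sum_le_sum fun i _ => (hF i).monotone h
  continuous := continuous_finsetSum _ fun i _ => (hF i).continuous
  eq_zero := fun t ht => Finset.sum_eq_zero fun i _ => (hF i).eq_zero t ht

/-- The exit time `τ(θ)` in terms of the aggregate cumulative inflow `F` and outflow `G`. -/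
noncomputable def cumulativeExitTime (ν c : ℝ) (F G : ℝ → ℝ) (θ : ℝ) : ℝ :=
  θ + (c + (F θ - G θ) / ν)

/-- The cumulative form of the condition that a flow over a single edge with inflows `F` and
outflows `G` respects the travel times. -/
structure IsCumulativeLoading {I : Type*} [Fintype I] (ν c : ℝ) (F G : I → ℝ → ℝ) : Prop where
  inflow : ∀ i, IsCumulative (F i)
  outflow : ∀ i, IsCumulative (G i)
  eq_outflow : ∀ i θ,
    F i θ = G i (cumulativeExitTime ν c (fun t => ∑ j, F j t) (fun t => ∑ j, G j t) θ)

theorem continuous_cumulativeExitTime {ν c : ℝ} {F G : ℝ → ℝ} (hF : Continuous F)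
    (hG : Continuous G) : Continuous (cumulativeExitTime ν c F G) := by
  unfold cumulativeExitTime
  fun_prop

theorem cumulativeExitTime_of_nonpos {ν c : ℝ} {F G : ℝ → ℝ} (hF : IsCumulative F)
    (hG : IsCumulative G) {θ : ℝ} (hθ : θ ≤ 0) : cumulativeExitTime ν c F G θ = θ + c := by
  simp [cumulativeExitTime, hF.eq_zero θ hθ, hG.eq_zero θ hθ]

theorem add_le_cumulativeExitTime_of_le {ν c : ℝ} (hν : 0 < ν) {F G : ℝ → ℝ} {θ : ℝ}
    (h : G θ ≤ F θ) : θ + c ≤ cumulativeExitTime ν c F G θ := by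
  have : 0 ≤ (F θ - G θ) / ν := div_nonneg (sub_nonneg.2 h) hν.le
  unfold cumulativeExitTime
  linarith

/-- Since the exit time is continuous, it could only fall below the entry time after a time at
which both coincide; but there all flow that has entered has left, so that the travel time is the
free-flow time `c > 0`. Hence flow never leaves before it has entered. -/
theorem outflow_le_inflow {ν c : ℝ} (hc : 0 < c) {F G : ℝ → ℝ}
    (hF : IsCumulative F) (hG : IsCumulative G)
    (h : ∀ θ, F θ = G (cumulativeExitTime ν c F G θ)) (θ : ℝ) : G θ ≤ F θ := by
  have hcont := continuous_cumulativeExitTime (ν := ν) (c := c) hF.continuous hG.continuous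
  have key : θ ≤ cumulativeExitTime ν c F G θ := by
    by_contra! hlt
    have h0 := cumulativeExitTime_of_nonpos (ν := ν) (c := c) hF hG (min_le_right θ 0)
    obtain ⟨x, -, hx⟩ := intermediate_value_Icc' (min_le_left θ 0)
      (f := fun t => cumulativeExitTime ν c F G t - t) (by fun_prop)
      (show (0 : ℝ) ∈ _ from ⟨by simpa using hlt.le, by rw [h0]; linarith⟩)
    have hx' : cumulativeExitTime ν c F G x = x := by simpa [sub_eq_zero] using hx
    have hFG : F x = G x := by rw [h x, hx']
    simp only [cumulativeExitTime, hFG, sub_self, zero_div, add_zero] at hx'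
    linarith
  rw [h θ]
  exact hG.monotone key

/-- Every time `t` is an exit time, of an entry time that is earlier by at least `c`. -/
theorem exists_cumulativeExitTime_eq {ν c : ℝ} (hν : 0 < ν) {F G : ℝ → ℝ}
    (hF : IsCumulative F) (hG : IsCumulative G) (h : ∀ θ, G θ ≤ F θ) (t : ℝ) :
    ∃ θ ≤ t - c, cumulativeExitTime ν c F G θ = t := by
  have hle : ∀ θ, θ + c ≤ cumulativeExitTime ν c F G θ :=
    fun θ => add_le_cumulativeExitTime_of_le hν (h θ)
  have h0 := cumulativeExitTime_of_nonpos (ν := ν) (c := c) hF hG (min_le_right (t - c) 0)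
  obtain ⟨x, hx, hxt⟩ := intermediate_value_Icc (min_le_left (t - c) 0)
    (continuous_cumulativeExitTime (ν := ν) (c := c) hF.continuous hG.continuous).continuousOn
    (show t ∈ _ from ⟨by rw [h0]; linarith [min_le_left (t - c) 0], by linarith [hle (t - c)]⟩)
  exact ⟨x, hx.2, hxt⟩

/-- Pointwise stability of the loading: on `(-∞, (n + 1) c]` the outflow is determined, through
the exit times, by the data on `(-∞, n c]`. The uniform Lipschitz bound on the outflows `Gs n`
absorbs the difference between the exit times of the sequence and those of the limit. -/
theorem IsCumulativeLoading.tendsto {I : Type*} [Fintype I] {ν c : ℝ} (hν : 0 < ν) (hc : 0 < c)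
    {Fs Gs : ℕ → I → ℝ → ℝ} {F G : I → ℝ → ℝ}
    (hs : ∀ n, IsCumulativeLoading ν c (Fs n) (Gs n)) (h : IsCumulativeLoading ν c F G)
    (hlip : ∀ n i x y, |Gs n i x - Gs n i y| ≤ ν * |x - y|)
    (hF : ∀ i t, Tendsto (fun n => Fs n i t) atTop (𝓝 (F i t))) (i : I) (t : ℝ) :
    Tendsto (fun n => Gs n i t) atTop (𝓝 (G i t)) := by
  have main : ∀ k : ℕ, ∀ t ≤ k * c, ∀ i, Tendsto (fun n => Gs n i t) atTop (𝓝 (G i t)) := by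
    intro k
    induction k with
    | zero =>
      intro t ht i
      have ht : t ≤ 0 := by simpa using ht
      simp only [(h.outflow i).eq_zero t ht, ((hs _).outflow i).eq_zero t ht]
      exact tendsto_const_nhds
    | succ k ih =>
      intro t ht i
      have hle := outflow_le_inflow (ν := ν) hc (IsCumulative.sum h.inflow)
        (IsCumulative.sum h.outflow) fun θ => Finset.sum_congr rfl fun j _ => h.eq_outflow j θ
      obtain ⟨θ, hθ, hθt⟩ := exists_cumulativeExitTime_eq (c := c) hν (IsCumulative.sum h.inflow)
        (IsCumulative.sum h.outflow) hle t
      have hθk : θ ≤ k * c := by push_cast at ht; linarith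
      have hτ : Tendsto (fun n => cumulativeExitTime ν c (fun t => ∑ j, Fs n j t)
          (fun t => ∑ j, Gs n j t) θ) atTop (𝓝 t) := by
        rw [← hθt]
        unfold cumulativeExitTime
        exact tendsto_const_nhds.add (tendsto_const_nhds.add
          (((tendsto_finsetSum _ fun j _ => hF j θ).sub
            (tendsto_finsetSum _ fun j _ => ih θ hθk j)).div_const ν))
      have h1 : Tendsto (fun n => Gs n i (cumulativeExitTime ν c (fun t => ∑ j, Fs n j t)
          (fun t => ∑ j, Gs n j t) θ)) atTop (𝓝 (G i t)) := by
        have := hF i θ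
        rw [h.eq_outflow i θ, hθt] at this
        exact this.congr fun n => (hs n).eq_outflow i θ
      refine tendsto_of_tendsto_of_dist h1 (squeeze_zero (fun _ => dist_nonneg)
        (fun n => (Real.dist_eq _ _).trans_le (hlip n i _ _)) ?_)
      simpa using ((hτ.sub_const t).abs.const_mul ν)
  obtain ⟨k, hk⟩ := exists_nat_ge (t / c)
  exact main k t ((div_le_iff₀ hc).1 hk) i

/-! ### Existence of the loading -/

/-- A function whose increments are dominated by those of `ν τ` factors through `τ`, and the factor
is monotone and `ν`-Lipschitz. -/
theorem exists_comp_eq_of_increments_le {τ H : ℝ → ℝ} {ν : ℝ} (hτ : Function.Surjective τ)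
    (h : ∀ x y, τ x ≤ τ y → H x ≤ H y ∧ H y - H x ≤ ν * (τ y - τ x)) :
    ∃ G : ℝ → ℝ, (∀ θ, G (τ θ) = H θ) ∧ Monotone G ∧
      ∀ x y, x ≤ y → G y - G x ≤ ν * (y - x) := by
  have hs := Function.surjInv_eq hτ
  refine ⟨fun t => H (Function.surjInv hτ t), fun θ => ?_, fun x y hxy => ?_, fun x y hxy => ?_⟩
  · exact le_antisymm (h _ _ (hs _).le).1 (h _ _ (hs _).ge).1
  · exact (h (Function.surjInv hτ x) (Function.surjInv hτ y) (by rwa [hs x, hs y])).1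
  · simpa only [hs] using
      (h (Function.surjInv hτ x) (Function.surjInv hτ y) (by rwa [hs x, hs y])).2

/-- The candidates for the aggregate cumulative outflow: monotone, of rate at most `ν`, and never
larger than the inflow. -/
structure IsAdmissibleOutflow (ν : ℝ) (F G : ℝ → ℝ) : Prop where
  monotone : Monotone G
  rate_le : ∀ x y, x ≤ y → G y - G x ≤ ν * (y - x)
  nonneg : ∀ t, 0 ≤ G t
  le_inflow : ∀ t, G t ≤ F t

theorem abs_sub_le_of_increments_le {G : ℝ → ℝ} {ν : ℝ} (hmono : Monotone G)
    (h : ∀ x y, x ≤ y → G y - G x ≤ ν * (y - x)) (x y : ℝ) : |G x - G y| ≤ ν * |x - y| := by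
  rcases le_total x y with hxy | hxy
  · rw [abs_sub_comm, abs_sub_comm x, abs_of_nonneg (sub_nonneg.2 hxy),
      abs_of_nonneg (sub_nonneg.2 (hmono hxy))]
    exact h x y hxy
  · rw [abs_of_nonneg (sub_nonneg.2 hxy), abs_of_nonneg (sub_nonneg.2 (hmono hxy))]
    exact h y x hxy

theorem lipschitzWith_of_increments_le {G : ℝ → ℝ} {ν : ℝ} (hmono : Monotone G)
    (h : ∀ x y, x ≤ y → G y - G x ≤ ν * (y - x)) : LipschitzWith ν.toNNReal G :=
  LipschitzWith.of_dist_le' fun x y => by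
    simpa only [Real.dist_eq] using abs_sub_le_of_increments_le hmono h x y

theorem IsAdmissibleOutflow.isCumulative {ν : ℝ} {F G : ℝ → ℝ} (hF : IsCumulative F)
    (hG : IsAdmissibleOutflow ν F G) : IsCumulative G where
  monotone := hG.monotone
  continuous := (lipschitzWith_of_increments_le hG.monotone hG.rate_le).continuous
  eq_zero := fun t ht => le_antisymm ((hG.le_inflow t).trans (hF.eq_zero t ht).le) (hG.nonneg t)

/-- For an outflow of rate at most `ν`, the exit time grows at least as fast as `F / ν`. -/
theorem IsAdmissibleOutflow.increments_le {ν c : ℝ} (hν : 0 < ν) {F G H : ℝ → ℝ}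
    (hG : IsAdmissibleOutflow ν F G) (hH : Monotone H)
    (hHF : ∀ x y, x ≤ y → H y - H x ≤ F y - F x) (x y : ℝ)
    (hxy : cumulativeExitTime ν c F G x ≤ cumulativeExitTime ν c F G y) :
    H x ≤ H y ∧
      H y - H x ≤ ν * (cumulativeExitTime ν c F G y - cumulativeExitTime ν c F G x) := by
  have key : ∀ x y, x ≤ y →
      H y - H x ≤ ν * (cumulativeExitTime ν c F G y - cumulativeExitTime ν c F G x) := by
    intro x y hxy
    have h1 := hG.rate_le x y hxy
    have h2 := hHF x y hxy
    have h3 : ν * (cumulativeExitTime ν c F G y - cumulativeExitTime ν c F G x)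
        = ν * (y - x) + ((F y - F x) - (G y - G x)) := by
      unfold cumulativeExitTime
      field_simp
      ring
    linarith
  rcases le_total x y with h | h
  · exact ⟨hH h, key x y h⟩
  · have h1 := key y x h
    have h2 := hH h
    have h3 : ν * (cumulativeExitTime ν c F G x - cumulativeExitTime ν c F G y) ≤ 0 :=
      mul_nonpos_of_nonneg_of_nonpos hν.le (by linarith)
    exact ⟨by linarith, by linarith [mul_nonneg hν.le (sub_nonneg.2 hxy)]⟩

/-- The outflow that results when the exit times are computed from an admissible outflow `G`. -/
theorem IsAdmissibleOutflow.exists_next {ν c : ℝ} (hν : 0 < ν) (hc : 0 < c) {F G : ℝ → ℝ}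
    (hF : IsCumulative F) (hG : IsAdmissibleOutflow ν F G) :
    ∃ G', IsAdmissibleOutflow ν F G' ∧ ∀ θ, G' (cumulativeExitTime ν c F G θ) = F θ := by
  have hex := exists_cumulativeExitTime_eq (c := c) hν hF (hG.isCumulative hF) hG.le_inflow
  obtain ⟨G', h1, h2, h3⟩ := exists_comp_eq_of_increments_le
    (τ := cumulativeExitTime ν c F G) (H := F) (ν := ν)
    (fun t => let ⟨θ, _, h⟩ := hex t; ⟨θ, h⟩)
    (hG.increments_le hν hF.monotone fun _ _ _ => le_rfl)
  refine ⟨G', ⟨h2, h3, fun t => ?_, fun t => ?_⟩, h1⟩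
  · obtain ⟨θ, -, rfl⟩ := hex t
    rw [h1]
    exact hF.nonneg θ
  · obtain ⟨θ, hθ, h⟩ := hex t
    rw [← h, h1, h]
    exact hF.monotone (by linarith)

/-- A larger outflow shortens the travel times and thus enlarges the resulting outflow, so that the
Knaster-Tarski argument yields an outflow consistent with its own exit times. -/
theorem exists_consistent_outflow {ν c : ℝ} (hν : 0 < ν) (hc : 0 < c) {F : ℝ → ℝ}
    (hF : IsCumulative F) :
    ∃ G, IsAdmissibleOutflow ν F G ∧ ∀ θ, G (cumulativeExitTime ν c F G θ) = F θ := by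
  have hnext : ∀ G : {G // IsAdmissibleOutflow ν F G}, ∃ G' : {G // IsAdmissibleOutflow ν F G},
      ∀ θ, G'.1 (cumulativeExitTime ν c F G.1 θ) = F θ := fun G =>
    let ⟨G', h, h'⟩ := G.2.exists_next hν hc hF
    ⟨⟨G', h⟩, h'⟩
  choose N hN using hnext
  have hmono : ∀ G H : {G // IsAdmissibleOutflow ν F G}, (∀ t, G.1 t ≤ H.1 t) →
      ∀ t, (N G).1 t ≤ (N H).1 t := by
    intro G H hGH t
    obtain ⟨θ, -, hθ⟩ :=
      exists_cumulativeExitTime_eq (c := c) hν hF (G.2.isCumulative hF) G.2.le_inflow t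
    have h1 := hN G θ
    rw [hθ] at h1
    rw [h1, ← hN H θ]
    refine (N H).2.monotone (le_trans ?_ hθ.le)
    unfold cumulativeExitTime
    gcongr
    exact hGH θ
  -- The fixed point is the supremum of the outflows `G` with `G ≤ N G`.
  let S := {G : {G // IsAdmissibleOutflow ν F G} // ∀ t, G.1 t ≤ (N G).1 t}
  have h0 : IsAdmissibleOutflow ν F fun _ => 0 :=
    ⟨monotone_const, fun x y h => by simpa using mul_nonneg hν.le (sub_nonneg.2 h),
      fun _ => le_rfl, hF.nonneg⟩
  -- The zero outflow makes the family of sub-solutions non-empty.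
  let z : S := ⟨⟨_, h0⟩, fun t => (N ⟨_, h0⟩).2.nonneg t⟩
  have : Nonempty S := ⟨z⟩
  have hbdd : ∀ t, BddAbove (range fun G : S => G.1.1 t) := fun t =>
    ⟨F t, by rintro _ ⟨G, rfl⟩; exact G.1.2.le_inflow t⟩
  have hsup : IsAdmissibleOutflow ν F fun t => ⨆ G : S, G.1.1 t := by
    refine ⟨fun x y hxy => ciSup_mono (hbdd y) fun G => G.1.2.monotone hxy, fun x y hxy => ?_,
      fun t => le_ciSup (hbdd t) z, fun t => ciSup_le fun G => G.1.2.le_inflow t⟩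
    rw [sub_le_iff_le_add]
    refine ciSup_le fun G => ?_
    linarith [G.1.2.rate_le x y hxy, le_ciSup (hbdd x) G]
  have hle : ∀ t, (⨆ G : S, G.1.1 t) ≤ (N ⟨_, hsup⟩).1 t := fun t =>
    ciSup_le fun G => (G.2 t).trans (hmono G.1 ⟨_, hsup⟩ (fun s => le_ciSup (hbdd s) G) t)
  have hge : ∀ t, (N ⟨_, hsup⟩).1 t ≤ ⨆ G : S, G.1.1 t := fun t =>
    le_ciSup (hbdd t) (⟨N ⟨_, hsup⟩, hmono _ _ hle⟩ : S)
  refine ⟨_, hsup, fun θ => ?_⟩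
  rw [← hN ⟨_, hsup⟩ θ]
  exact le_antisymm (hle _) (hge _)

theorem exists_isCumulativeLoading {I : Type*} [Fintype I] {ν c : ℝ} (hν : 0 < ν) (hc : 0 < c)
    {F : I → ℝ → ℝ} (hF : ∀ i, IsCumulative (F i)) :
    ∃ G : I → ℝ → ℝ, IsCumulativeLoading ν c F G ∧
      ∀ i x y, x ≤ y → G i y - G i x ≤ ν * (y - x) := by
  obtain ⟨A, hA, hAF⟩ := exists_consistent_outflow hν hc (IsCumulative.sum hF)
  have hex := exists_cumulativeExitTime_eq (c := c) hν (IsCumulative.sum hF)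
    (hA.isCumulative (IsCumulative.sum hF)) hA.le_inflow
  have hi : ∀ i, ∃ G : ℝ → ℝ,
      (∀ θ, G (cumulativeExitTime ν c (fun t => ∑ j, F j t) A θ) = F i θ) ∧ Monotone G ∧
        ∀ x y, x ≤ y → G y - G x ≤ ν * (y - x) := by
    intro i
    refine exists_comp_eq_of_increments_le (fun t => let ⟨θ, _, h⟩ := hex t; ⟨θ, h⟩)
      (hA.increments_le hν (hF i).monotone fun x y hxy => ?_)
    rw [← Finset.sum_sub_distrib]
    exact Finset.single_le_sum (f := fun j => F j y - F j x)
      (fun j _ => sub_nonneg.2 ((hF j).monotone hxy)) (Finset.mem_univ i)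
  choose G hG hmono hrate using hi
  have hsum : (fun t => ∑ j, G j t) = A := by
    funext t
    obtain ⟨θ, -, rfl⟩ := hex t
    rw [hAF θ]
    exact Finset.sum_congr rfl fun j _ => hG j θ
  refine ⟨G, ⟨hF, fun i => ⟨hmono i,
    (lipschitzWith_of_increments_le (hmono i) (hrate i)).continuous, fun t ht => ?_⟩,
    fun i θ => by rw [hsum]; exact (hG i θ).symm⟩, hrate⟩
  obtain ⟨θ, hθ, rfl⟩ := hex t
  rw [hG, (hF i).eq_zero θ (by linarith)]

/-- Comparison with the Lipschitz outflow constructed above, through the stability of the loading,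
shows that every outflow coincides with it. -/
theorem IsCumulativeLoading.rate_le {I : Type*} [Fintype I] {ν c : ℝ} (hν : 0 < ν) (hc : 0 < c)
    {F G : I → ℝ → ℝ} (h : IsCumulativeLoading ν c F G) (i : I) (x y : ℝ) (hxy : x ≤ y) :
    G i y - G i x ≤ ν * (y - x) := by
  obtain ⟨G', h', hr⟩ := exists_isCumulativeLoading hν hc h.inflow
  have heq : ∀ t, G' i t = G i t := fun t => tendsto_nhds_unique tendsto_const_nhds <|
    IsCumulativeLoading.tendsto hν hc (fun _ : ℕ => h') h
      (fun _ i => abs_sub_le_of_increments_le (h'.outflow i).monotone (hr i))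
      (fun _ _ => tendsto_const_nhds) i t
  rw [← heq, ← heq]
  exact hr i x y hxy

theorem IsCumulativeLoading.unique {I : Type*} [Fintype I] {ν c : ℝ} (hν : 0 < ν) (hc : 0 < c)
    {F G G' : I → ℝ → ℝ} (h : IsCumulativeLoading ν c F G) (h' : IsCumulativeLoading ν c F G') :
    G = G' := by
  funext i t
  exact tendsto_nhds_unique tendsto_const_nhds <|
    IsCumulativeLoading.tendsto hν hc (fun _ : ℕ => h) h'
      (fun _ i => abs_sub_le_of_increments_le (h.outflow i).monotone (h.rate_le hν hc i))
      (fun _ _ => tendsto_const_nhds) i t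

/-! ### Functionals on `L^p` and bounded functions -/

section Lp
variable {α : Type*} [MeasurableSpace α] {μ : Measure α}

theorem hasSum_indicatorConstLp_iUnion {p : ℝ≥0∞} [Fact (1 ≤ p)] (hp : p ≠ ∞) {A : ℕ → Set α}
    (hA : ∀ i, MeasurableSet (A i)) (hd : Pairwise (Function.onFun Disjoint A))
    (hμ : ∀ i, μ (A i) ≠ ∞) (hU : μ (⋃ i, A i) ≠ ∞) :
    HasSum (fun i => indicatorConstLp p (hA i) (hμ i) (1 : ℝ))
      (indicatorConstLp p (MeasurableSet.iUnion hA) hU (1 : ℝ)) := by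
  have hf : ∀ s : Finset ℕ, μ (⋃ i ∈ s, A i) ≠ ∞ := fun s =>
    ne_top_of_le_ne_top hU (measure_mono (iUnion₂_subset fun i _ => subset_iUnion A i))
  have hsum : ∀ s : Finset ℕ, ∑ i ∈ s, indicatorConstLp p (hA i) (hμ i) (1 : ℝ) =
      indicatorConstLp p (s.measurableSet_biUnion fun i _ => hA i) (hf s) (1 : ℝ) := by
    intro s
    induction s using Finset.induction_on with
    | empty => simp
    | insert a s ha ih =>
      rw [Finset.sum_insert ha, ih, ← indicatorConstLp_disjoint_union (hA a)
        (s.measurableSet_biUnion fun i _ => hA i) (hμ a) (hf s)]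
      · congr 1
        simp
      · exact disjoint_iUnion₂_right.2 fun i hi => hd (by rintro rfl; exact ha hi)
  unfold HasSum
  simp only [hsum]
  refine tendsto_indicatorConstLp_set hp ?_
  have hsub : ∀ s : Finset ℕ, μ (symmDiff (⋃ i ∈ s, A i) (⋃ i, A i)) ≤
      ∑' i : {i // i ∉ s}, μ (A i) := by
    intro s
    refine (measure_mono ?_).trans (measure_iUnion_le _)
    rintro x (⟨h1, h2⟩ | ⟨h1, h2⟩)
    · simp only [mem_iUnion] at h1 h2
      obtain ⟨i, -, hi⟩ := h1
      exact (h2 ⟨i, hi⟩).elim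
    · simp only [mem_iUnion, not_exists] at h1 h2 ⊢
      obtain ⟨i, hi⟩ := h1
      exact ⟨⟨i, fun his => h2 i his hi⟩, hi⟩
  refine tendsto_of_tendsto_of_tendsto_of_le_of_le tendsto_const_nhds
    (ENNReal.tendsto_tsum_compl_atTop_zero (f := fun i => μ (A i)) ?_) (fun _ => zero_le) hsub
  rwa [← measure_iUnion hd hA]

/-- The signed measure `A ↦ ℓ(1_{A ∩ S})` of a functional `ℓ` on `L^p` and a set `S` of finite
measure. -/
noncomputable def functionalSignedMeasure {p : ℝ≥0∞} [Fact (1 ≤ p)] (hp : p ≠ ∞)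
    (l : Lp ℝ p μ →L[ℝ] ℝ) {S : Set α} (hS : MeasurableSet S) (hμS : μ S ≠ ∞) :
    SignedMeasure α := by
  classical
  exact
  { measureOf' := fun A => if hA : MeasurableSet A then
      l (indicatorConstLp p (hA.inter hS)
        (ne_top_of_le_ne_top hμS (measure_mono inter_subset_right)) 1) else 0
    empty' := by simp
    not_measurable' := fun A hA => by simp [hA]
    m_iUnion' := fun A hA hd => by
      simp only [hA, MeasurableSet.iUnion hA, dif_pos]
      have h := hasSum_indicatorConstLp_iUnion (μ := μ) hp (A := fun i => A i ∩ S)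
        (fun i => (hA i).inter hS)
        (fun i j hij => (hd hij).mono inter_subset_left inter_subset_left)
        (fun i => ne_top_of_le_ne_top hμS (measure_mono inter_subset_right))
        (ne_top_of_le_ne_top hμS (measure_mono (iUnion_subset fun _ => inter_subset_right)))
      have h' := h.mapL l
      simpa only [iUnion_inter] using h' }

theorem functionalSignedMeasure_apply {p : ℝ≥0∞} [Fact (1 ≤ p)] (hp : p ≠ ∞)
    (l : Lp ℝ p μ →L[ℝ] ℝ) {S : Set α} (hS : MeasurableSet S) (hμS : μ S ≠ ∞) {A : Set α}
    (hA : MeasurableSet A) :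
    functionalSignedMeasure hp l hS hμS A = l (indicatorConstLp p (hA.inter hS)
        (ne_top_of_le_ne_top hμS (measure_mono inter_subset_right)) 1) :=
  dif_pos hA

theorem tendsto_eLpNorm_sub_of_dominated {p : ℝ≥0∞} (hp0 : p ≠ 0) (hp : p ≠ ∞) {fs : ℕ → α → ℝ}
    {f g : α → ℝ} (hfs : ∀ n, AEStronglyMeasurable (fs n) μ) (hf : AEStronglyMeasurable f μ)
    (hg : MemLp g p μ) (hbound : ∀ n, ∀ᵐ x ∂μ, |fs n x - f x| ≤ g x)
    (hlim : ∀ᵐ x ∂μ, Tendsto (fun n => fs n x) atTop (𝓝 (f x))) :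
    Tendsto (fun n => eLpNorm (fs n - f) p μ) atTop (𝓝 0) := by
  have hp' : 0 < p.toReal := ENNReal.toReal_pos hp0 hp
  simp only [eLpNorm_eq_lintegral_rpow_enorm_toReal hp0 hp]
  have h1 : Tendsto (fun n => ∫⁻ x, ‖(fs n - f) x‖ₑ ^ p.toReal ∂μ) atTop (𝓝 (∫⁻ _, 0 ∂μ)) := by
    refine tendsto_lintegral_of_dominated_convergence' (fun x => ‖g x‖ₑ ^ p.toReal)
      (fun n => ((hfs n).sub hf).enorm.pow_const _) (fun n => ?_)
      (lintegral_rpow_enorm_lt_top_of_eLpNorm_lt_top hp0 hp hg.2).ne ?_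
    · filter_upwards [hbound n] with x hx
      gcongr
      exact enorm_le_iff_norm_le.2 (hx.trans (le_abs_self _))
    · filter_upwards [hlim] with x hx
      have h2 : Tendsto (fun n => ‖fs n x - f x‖ₑ) atTop (𝓝 0) := by
        simpa using (hx.sub_const (f x)).enorm
      have h3 := (ENNReal.continuous_rpow_const (y := p.toReal)).tendsto 0
      rw [ENNReal.zero_rpow_of_pos hp'] at h3
      exact h3.comp h2
  have h3 := (ENNReal.continuous_rpow_const (y := 1 / p.toReal)).tendsto 0
  rw [ENNReal.zero_rpow_of_pos (by positivity)] at h3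
  rw [lintegral_zero] at h1
  exact h3.comp h1

/-- On bounded functions that vanish outside a set of finite measure, a functional on `L^p` is
integration against an integrable function, the Radon-Nikodym density of
`functionalSignedMeasure`. -/
theorem exists_integrable_apply_eq_integral [SigmaFinite μ] {p : ℝ≥0∞} [Fact (1 ≤ p)] (hp : p ≠ ∞)
    (l : Lp ℝ p μ →L[ℝ] ℝ) {S : Set α} (hS : MeasurableSet S) (hμS : μ S ≠ ∞) :
    ∃ h : α → ℝ, Integrable h μ ∧ ∀ (u : Lp ℝ p μ) (C : ℝ), (∀ᵐ x ∂μ, |u x| ≤ C) →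
      (∀ᵐ x ∂μ, x ∉ S → u x = 0) → l u = ∫ x, h x * u x ∂μ := by
  set s := functionalSignedMeasure hp l hS hμS with hs
  have hac : s ≪ᵥ μ.toENNRealVectorMeasure := by
    refine VectorMeasure.AbsolutelyContinuous.mk fun A hA hA0 => ?_
    rw [Measure.toENNRealVectorMeasure_apply_measurable hA] at hA0
    rw [hs, functionalSignedMeasure_apply hp l hS hμS hA]
    have h0 : μ (A ∩ S) = 0 := measure_mono_null inter_subset_left hA0
    have : indicatorConstLp p (hA.inter hS)
        (ne_top_of_le_ne_top hμS (measure_mono inter_subset_right)) (1 : ℝ) = 0 := by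
      rw [Lp.eq_zero_iff_ae_eq_zero]
      filter_upwards [indicatorConstLp_coeFn_notMem (p := p) (hs := hA.inter hS)
        (hμs := ne_top_of_le_ne_top hμS (measure_mono inter_subset_right)) (c := (1 : ℝ)),
        measure_eq_zero_iff_ae_notMem.1 h0] with x h1 h2 using h1 h2
    rw [this, map_zero]
  have hint : Integrable (s.rnDeriv μ) μ := SignedMeasure.integrable_rnDeriv s μ
  have hset : ∀ A, MeasurableSet A → ∫ x in A, s.rnDeriv μ x ∂μ = s A := fun A hA => by
    rw [← withDensityᵥ_apply hint hA, SignedMeasure.withDensityᵥ_rnDeriv_eq s μ hac]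
  have hmem : ∀ φ : SimpleFunc α ℝ, MemLp (S.indicator φ) p μ := fun φ => by
    have hfin : IsFiniteMeasure (μ.restrict S) := ⟨by simpa using hμS.lt_top⟩
    exact (memLp_indicator_iff_restrict hS).2 (φ.memLp_of_isFiniteMeasure p _)
  have hmul : ∀ φ : SimpleFunc α ℝ, Integrable (fun x => s.rnDeriv μ x * S.indicator φ x) μ := by
    intro φ
    obtain ⟨C, hC⟩ := φ.exists_forall_norm_le
    refine hint.mul_bdd (c := C) (hmem φ).1 (Eventually.of_forall fun x => ?_)
    exact (norm_indicator_le_norm_self _ _).trans (hC x)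
  have hsimple : ∀ φ : SimpleFunc α ℝ,
      l ((hmem φ).toLp _) = ∫ x, s.rnDeriv μ x * S.indicator φ x ∂μ := by
    intro φ
    induction φ using SimpleFunc.induction with
    | const c hA =>
      rename_i A
      have h1 : (hmem (SimpleFunc.piecewise A hA (SimpleFunc.const α c) (SimpleFunc.const α 0))).toLp
          _ = c • indicatorConstLp p (hA.inter hS)
            (ne_top_of_le_ne_top hμS (measure_mono inter_subset_right)) (1 : ℝ) := by
        rw [Lp.ext_iff]
        filter_upwards [MemLp.coeFn_toLp (hmem (SimpleFunc.piecewise A hA (SimpleFunc.const α c)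
          (SimpleFunc.const α 0))), Lp.coeFn_smul c (indicatorConstLp p (hA.inter hS)
            (ne_top_of_le_ne_top hμS (measure_mono inter_subset_right)) (1 : ℝ)),
          indicatorConstLp_coeFn (p := p) (hs := hA.inter hS)
            (hμs := ne_top_of_le_ne_top hμS (measure_mono inter_subset_right)) (c := (1 : ℝ))]
          with x h1 h2 h3
        rw [h1, h2, Pi.smul_apply, h3]
        by_cases hxA : x ∈ A <;> by_cases hxS : x ∈ S <;> simp [hxA, hxS]
      rw [h1, map_smul, ← functionalSignedMeasure_apply hp l hS hμS hA, ← hs]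
      have hAS : s A = s (A ∩ S) := by
        rw [hs, functionalSignedMeasure_apply hp l hS hμS hA,
          functionalSignedMeasure_apply hp l hS hμS (hA.inter hS)]
        congr 2
        simp [inter_assoc]
      rw [hAS, ← hset _ (hA.inter hS), ← integral_indicator (hA.inter hS), smul_eq_mul,
        ← integral_const_mul]
      congr 1
      funext x
      by_cases hxA : x ∈ A <;> by_cases hxS : x ∈ S <;> simp [hxA, hxS, mul_comm]
    | add hd h1 h2 =>
      rename_i f g
      have h3 : (hmem (f + g)).toLp _ = (hmem f).toLp _ + (hmem g).toLp _ := by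
        rw [← MemLp.toLp_add]
        congr 1
        simp [indicator_add']
      rw [h3, map_add, h1, h2, ← integral_add (hmul f) (hmul g)]
      congr 1
      funext x
      simp [indicator_add', mul_add]
  refine ⟨s.rnDeriv μ, hint, fun u C hC hu => ?_⟩
  have hC' : ∀ᵐ x ∂μ, ‖u x‖ ≤ max C 0 := by
    filter_upwards [hC] with x hx using hx.trans (le_max_left _ _)
  have hum := Lp.stronglyMeasurable u
  set φ := fun n => hum.approxBounded (max C 0) n
  -- The approximation by simple functions keeps the bound, so that both sides converge dominatedly.
  have hφC : ∀ n x, ‖φ n x‖ ≤ max C 0 := hum.norm_approxBounded_le (le_max_right _ _)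
  have hφu : ∀ᵐ x ∂μ, Tendsto (fun n => S.indicator (φ n) x) atTop (𝓝 (u x)) := by
    filter_upwards [hum.tendsto_approxBounded_ae hC', hu] with x hx hxS
    by_cases h : x ∈ S
    · simpa [h] using hx
    · simp [h, hxS h]
  have h1 : Tendsto (fun n => (hmem (φ n)).toLp _) atTop (𝓝 u) := by
    have hp0 : p ≠ 0 := (zero_lt_one.trans_le (Fact.out : 1 ≤ p)).ne'
    rw [← Lp.toLp_coeFn u (Lp.memLp u),
      Lp.tendsto_Lp_iff_tendsto_eLpNorm'' _ (fun n => hmem (φ n)) _ (Lp.memLp u)]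
    refine tendsto_eLpNorm_sub_of_dominated hp0 hp (fun n => (hmem (φ n)).1) (Lp.memLp u).1
      (memLp_indicator_const p hS (max C 0 + max C 0) (Or.inr hμS)) (fun n => ?_) hφu
    filter_upwards [hC', hu] with x h1 h2
    by_cases h : x ∈ S
    · simp only [h, indicator_of_mem]
      exact (abs_sub _ _).trans (add_le_add (hφC n x) h1)
    · simp [h, h2 h]
  have h2 : Tendsto (fun n => ∫ x, s.rnDeriv μ x * S.indicator (φ n) x ∂μ) atTop
      (𝓝 (∫ x, s.rnDeriv μ x * u x ∂μ)) := by
    refine tendsto_integral_of_dominated_convergence (fun x => |s.rnDeriv μ x| * max C 0)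
      (fun n => (hmul (φ n)).1) (hint.abs.mul_const _) (fun n => Eventually.of_forall fun x => ?_) ?_
    · rw [norm_mul]
      exact mul_le_mul_of_nonneg_left ((norm_indicator_le_norm_self _ _).trans (hφC n x))
        (norm_nonneg _)
    · filter_upwards [hφu] with x hx using hx.const_mul _
  refine tendsto_nhds_unique ((l.continuous.tendsto u).comp h1) (h2.congr fun n => ?_)
  exact (hsimple (φ n)).symm

end Lp

/-- For bounded functions on a set of finite measure, convergence of the primitives implies
convergence of the integrals over all measurable sets. -/
theorem tendsto_setIntegral_of_tendsto_primitive {S : Set ℝ} (hS : MeasurableSet S)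
    (hvS : volume S ≠ ∞) {us : ℕ → ℝ → ℝ} {u : ℝ → ℝ} {C : ℝ}
    (hus : ∀ n, Integrable (us n)) (hu : Integrable u)
    (hb : ∀ n, ∀ᵐ x, |us n x| ≤ C) (hz : ∀ n, ∀ᵐ x, x ∉ S → us n x = 0)
    (h : ∀ a b, Tendsto (fun n => ∫ x in a..b, us n x) atTop (𝓝 (∫ x in a..b, u x)))
    (htot : Tendsto (fun n => ∫ x, us n x) atTop (𝓝 (∫ x, u x)))
    {A : Set ℝ} (hA : MeasurableSet A) :
    Tendsto (fun n => ∫ x in A, us n x) atTop (𝓝 (∫ x in A, u x)) := by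
  induction A, hA using MeasurableSpace.induction_on_inter (borel_eq_generateFrom_Ioc ℝ)
    (isPiSystem_Ioc id id) with
  | empty => simp
  | basic t ht =>
    obtain ⟨a, b, hab, rfl⟩ := ht
    have := h a b
    simpa only [intervalIntegral.integral_of_le (le_of_lt hab)] using this
  | compl t ht ih =>
    have e : ∀ v : ℝ → ℝ, Integrable v → ∫ x in tᶜ, v x = (∫ x, v x) - ∫ x in t, v x :=
      fun v hv => by rw [← integral_add_compl ht hv]; ring
    simp only [e _ (hus _), e _ hu]
    exact htot.sub ih
  | iUnion f hd hf ih =>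
    have e : ∀ v : ℝ → ℝ, Integrable v → ∫ x in ⋃ i, f i, v x = ∑' i, ∫ x in f i, v x :=
      fun v hv => integral_iUnion hf hd hv.integrableOn
    simp only [e _ (hus _), e _ hu]
    have hfin : ∀ i, volume (f i ∩ S) < ∞ := fun i =>
      (measure_mono inter_subset_right).trans_lt hvS.lt_top
    -- Only the part of `f i` in `S` counts, and these parts have summable measures.
    refine tendsto_tsum_of_dominated_convergence (bound := fun i => C * volume.real (f i ∩ S))
      ?_ ih (Eventually.of_forall fun n i => ?_)
    · refine Summable.mul_left C ?_
      refine ENNReal.summable_toReal ?_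
      rw [← measure_iUnion (fun i j hij => (hd hij).mono inter_subset_left inter_subset_left)
        fun i => (hf i).inter hS]
      exact ne_top_of_le_ne_top hvS (measure_mono (iUnion_subset fun _ => inter_subset_right))
    · have : ∫ x in f i, us n x = ∫ x in f i ∩ S, us n x := by
        rw [← setIntegral_indicator hS]
        refine setIntegral_congr_ae (hf i) ?_
        filter_upwards [hz n] with x hx _
        by_cases hxS : x ∈ S
        · simp [hxS]
        · simp [hxS, hx hxS]
      rw [this]
      refine norm_setIntegral_le_of_norm_le_const_ae (hfin i) ?_
      exact ae_restrict_of_ae (hb n)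

/-- For uniformly bounded functions, convergence of the integrals over measurable sets extends to
integrals against integrable weights, by density of the simple functions in `L¹`. -/
theorem tendsto_integral_mul_of_tendsto_setIntegral {α : Type*} [MeasurableSpace α]
    {μ : Measure α} {us : ℕ → α → ℝ} {u : α → ℝ}
    {C : ℝ} (hus : ∀ n, AEStronglyMeasurable (us n) μ) (hu : AEStronglyMeasurable u μ)
    (hb : ∀ n, ∀ᵐ x ∂μ, |us n x| ≤ C) (hbu : ∀ᵐ x ∂μ, |u x| ≤ C)
    (h : ∀ A, MeasurableSet A → Tendsto (fun n => ∫ x in A, us n x ∂μ) atTop (𝓝 (∫ x in A, u x ∂μ)))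
    {w : α → ℝ} (hw : Integrable w μ) :
    Tendsto (fun n => ∫ x, w x * us n x ∂μ) atTop (𝓝 (∫ x, w x * u x ∂μ)) := by
  have hI : ∀ {f v : α → ℝ}, Integrable f μ → AEStronglyMeasurable v μ →
      (∀ᵐ x ∂μ, |v x| ≤ C) → Integrable (fun x => f x * v x) μ :=
    fun hf hv hvC => hf.mul_bdd hv hvC
  refine Integrable.induction (μ := μ) (P := fun w => Tendsto (fun n => ∫ x, w x * us n x ∂μ) atTop
    (𝓝 (∫ x, w x * u x ∂μ))) ?_ ?_ ?_ ?_ hw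
  · intro c s hs hμs
    have e : ∀ v : α → ℝ, ∫ x, s.indicator (fun _ => c) x * v x ∂μ = c * ∫ x in s, v x ∂μ := by
      intro v
      rw [← integral_const_mul, ← integral_indicator hs]
      congr 1
      funext x
      by_cases hx : x ∈ s <;> simp [hx]
    simp only [e]
    exact (h s hs).const_mul c
  · intro f g _ hf hg h1 h2
    have e : ∀ v : α → ℝ, AEStronglyMeasurable v μ → (∀ᵐ x ∂μ, |v x| ≤ C) →
        ∫ x, (f + g) x * v x ∂μ = ∫ x, f x * v x ∂μ + ∫ x, g x * v x ∂μ := fun v hv hvC => by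
      rw [← integral_add (hI hf hv hvC) (hI hg hv hvC)]
      simp [add_mul]
    simp only [e _ (hus _) (hb _), e _ hu hbu]
    exact h1.add h2
  · refine isClosed_of_closure_subset fun f hf => ?_
    have hdiff : ∀ (g : α →₁[μ] ℝ) (v : α → ℝ), AEStronglyMeasurable v μ →
        (∀ᵐ x ∂μ, |v x| ≤ C) →
        |∫ x, f x * v x ∂μ - ∫ x, g x * v x ∂μ| ≤ dist f g * |C| := by
      intro g v hv hvC
      have hf1 := L1.integrable_coeFn f
      have hg1 := L1.integrable_coeFn g
      rw [← integral_sub (hI hf1 hv hvC) (hI hg1 hv hvC), L1.dist_eq_integral_dist,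
        ← integral_mul_const]
      have hd : Integrable (fun x => dist (f x) (g x) * |C|) μ := (hf1.sub hg1).abs.mul_const _
      rw [← Real.norm_eq_abs]
      refine norm_integral_le_of_norm_le hd ?_
      filter_upwards [hvC] with x hx
      rw [← sub_mul, norm_mul, Real.dist_eq]
      exact mul_le_mul_of_nonneg_left (hx.trans (le_abs_self C)) (norm_nonneg _)
    rw [mem_ofPred_eq, Metric.tendsto_atTop]
    intro ε hε
    obtain ⟨g, hg, hfg⟩ := Metric.mem_closure_iff.1 hf (ε / (3 * (|C| + 1))) (by positivity)
    obtain ⟨N, hN⟩ := Metric.tendsto_atTop.1 hg (ε / 3) (by positivity)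
    refine ⟨N, fun n hn => ?_⟩
    have hsmall : dist f g * |C| ≤ ε / 3 := by
      have h3 : dist f g * (|C| + 1) ≤ ε / (3 * (|C| + 1)) * (|C| + 1) := by gcongr
      have h4 : ε / (3 * (|C| + 1)) * (|C| + 1) = ε / 3 := by field_simp
      nlinarith [dist_nonneg (x := f) (y := g)]
    have h1 := abs_le.1 ((hdiff g _ (hus n) (hb n)).trans hsmall)
    have h2 := abs_le.1 ((hdiff g _ hu hbu).trans hsmall)
    have h3 := abs_lt.1 (hN n hn)
    rw [Real.dist_eq, abs_lt]
    constructor <;> linarith [h1.1, h1.2, h2.1, h2.2, h3.1, h3.2]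
  · intro f g hfg hf h1
    have e : ∀ v : α → ℝ, ∫ x, g x * v x ∂μ = ∫ x, f x * v x ∂μ := fun v =>
      integral_congr_ae (by filter_upwards [hfg] with x hx; rw [hx])
    simpa only [e] using h1

/-- On uniformly bounded rates on `[0, T]`, pointwise convergence of the primitives implies weak
convergence in `L^p`. -/
theorem tendsto_apply_of_tendsto_primitive {p : ℝ≥0∞} [Fact (1 ≤ p)] (hp : p ≠ ∞) {T C : ℝ}
    {us : ℕ → Lp ℝ p (volume : Measure ℝ)} {u : Lp ℝ p (volume : Measure ℝ)}
    (hb : ∀ n, ∀ᵐ x, |us n x| ≤ C) (hbu : ∀ᵐ x, |u x| ≤ C)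
    (hz : ∀ n, ∀ᵐ x, x ∉ Icc 0 T → us n x = 0) (hzu : ∀ᵐ x, x ∉ Icc 0 T → u x = 0)
    (h : ∀ t, Tendsto (fun n => ∫ x in (0 : ℝ)..t, us n x) atTop (𝓝 (∫ x in (0 : ℝ)..t, u x)))
    (l : Lp ℝ p (volume : Measure ℝ) →L[ℝ] ℝ) :
    Tendsto (fun n => l (us n)) atTop (𝓝 (l u)) := by
  have hvS : volume (Icc 0 T) ≠ ∞ := measure_Icc_lt_top.ne
  have hint : ∀ v : Lp ℝ p (volume : Measure ℝ), (∀ᵐ x, x ∉ Icc 0 T → v x = 0) → Integrable v := by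
    intro v hv
    have hfin : IsFiniteMeasure ((volume : Measure ℝ).restrict (Icc 0 T)) := ⟨by simp⟩
    have h1 : IntegrableOn v (Icc 0 T) := ((Lp.memLp v).restrict _).integrable Fact.out
    exact h1.integrable_of_ae_notMem_eq_zero hv
  have htot : ∀ v : Lp ℝ p (volume : Measure ℝ), (∀ᵐ x, x ∉ Icc 0 T → v x = 0) →
      ∫ x, v x = ∫ x in (0 : ℝ)..(max 0 T), v x := by
    intro v hv
    rw [intervalIntegral.integral_of_le (le_max_left _ _), ← integral_Icc_eq_integral_Ioc]
    refine (setIntegral_eq_integral_of_ae_compl_eq_zero ?_).symm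
    filter_upwards [hv] with x hx hx'
    exact hx fun hx'' => hx' ⟨hx''.1, hx''.2.trans (le_max_right _ _)⟩
  obtain ⟨w, hw, hl⟩ := exists_integrable_apply_eq_integral (μ := volume) hp l
    (S := Icc 0 T) measurableSet_Icc hvS
  rw [hl u C hbu hzu]
  simp only [hl _ C (hb _) (hz _)]
  refine tendsto_integral_mul_of_tendsto_setIntegral (fun n => (Lp.memLp (us n)).1) (Lp.memLp u).1
    hb hbu (fun A hA => ?_) hw
  refine tendsto_setIntegral_of_tendsto_primitive measurableSet_Icc hvS (fun n => hint _ (hz n))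
    (hint _ hzu) hb hz (fun a b => ?_) ?_ hA
  · have e : ∀ v : Lp ℝ p (volume : Measure ℝ), Integrable v →
        ∫ x in a..b, v x = (∫ x in (0 : ℝ)..b, v x) - ∫ x in (0 : ℝ)..a, v x := fun v hv =>
      (intervalIntegral.integral_interval_sub_left hv.intervalIntegrable
        hv.intervalIntegrable).symm
    simp only [e _ (hint _ (hz _)), e _ (hint _ hzu)]
    exact (h b).sub (h a)
  · simp only [htot _ (hz _), htot _ hzu]
    exact h _

/-! ### Rate functions and their primitives -/

/-- The primitive `θ ↦ ∫_0^θ f` of a rate function. -/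
noncomputable def Rate.primitive {p : ℝ≥0∞} (f : Rate p) (θ : ℝ) : ℝ := ∫ s in (0 : ℝ)..θ, f s

theorem Rate.primitive_of_nonpos {p : ℝ≥0∞} (f : Rate p) {θ : ℝ} (hθ : θ ≤ 0) :
    f.primitive θ = 0 := by
  refine intervalIntegral.integral_zero_ae ?_
  have h0 : ∀ᵐ s : ℝ, s ≠ 0 := by simp [ae_iff]
  filter_upwards [f.2.2.1, h0] with s hs hs0 hmem
  rw [uIoc_of_ge hθ] at hmem
  exact hs (lt_of_le_of_ne hmem.2 hs0)

theorem Rate.isCumulative {p : ℝ≥0∞} (hp : 1 ≤ p) (f : Rate p) : IsCumulative f.primitive where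
  monotone := fun x y hxy => by
    have h : f.primitive y - f.primitive x = ∫ s in x..y, f s :=
      intervalIntegral.integral_interval_sub_left (f.intervalIntegrable hp _ _)
        (f.intervalIntegrable hp _ _)
    rw [← sub_nonneg, h]
    exact intervalIntegral.integral_nonneg_of_ae hxy f.2.1
  continuous := intervalIntegral.continuous_primitive (f.intervalIntegrable hp) 0
  eq_zero := fun _ => f.primitive_of_nonpos

theorem Rate.locallyIntegrable {p : ℝ≥0∞} (hp : 1 ≤ p) (f : Rate p) :
    LocallyIntegrable f volume := by
  refine (locallyIntegrable_iff).2 fun K hK => ?_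
  have : IsFiniteMeasure ((volume : Measure ℝ).restrict K) := ⟨by simpa using hK.measure_lt_top⟩
  exact (f.2.2.2 K hK).integrable hp

/-- The rate is recovered from the primitive by Lebesgue differentiation. -/
theorem Rate.ae_hasDerivAt_primitive {p : ℝ≥0∞} (hp : 1 ≤ p) (f : Rate p) :
    ∀ᵐ θ, HasDerivAt f.primitive (f θ) θ := by
  filter_upwards [LocallyIntegrable.ae_hasDerivAt_integral (f.locallyIntegrable hp)] with θ h
    using h 0

theorem Rate.ext_of_primitive {p : ℝ≥0∞} (hp : 1 ≤ p) {f g : Rate p}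
    (h : f.primitive = g.primitive) : f = g := by
  refine Subtype.ext (AEEqFun.ext ?_)
  filter_upwards [f.ae_hasDerivAt_primitive hp, g.ae_hasDerivAt_primitive hp] with θ h1 h2
  rw [h] at h1
  exact h1.unique h2

theorem Rate.ae_abs_le {p : ℝ≥0∞} (hp : 1 ≤ p) (f : Rate p) {ν : ℝ} (hν : 0 ≤ ν)
    (h : ∀ x y, x ≤ y → f.primitive y - f.primitive x ≤ ν * (y - x)) : ∀ᵐ θ, |f θ| ≤ ν := by
  filter_upwards [f.ae_hasDerivAt_primitive hp] with θ hθ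
  have := hθ.le_of_lipschitz (lipschitzWith_of_increments_le (f.isCumulative hp).monotone h)
  rwa [Real.coe_toNNReal _ hν] at this

/-- A cumulative flow of bounded rate is the primitive of its derivative. -/
theorem exists_rate_primitive_eq {p : ℝ≥0∞} {ν : ℝ} {G : ℝ → ℝ} (hG : IsCumulative G)
    (h : ∀ x y, x ≤ y → G y - G x ≤ ν * (y - x)) : ∃ g : Rate p, g.primitive = G := by
  have hlip := lipschitzWith_of_increments_le hG.monotone h
  have hm : AEStronglyMeasurable (deriv G) volume := (measurable_deriv G).aestronglyMeasurable
  have hmk := AEEqFun.coeFn_mk (deriv G) hm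
  refine ⟨⟨AEEqFun.mk (deriv G) hm, ?_, ?_, fun K hK => ?_⟩, ?_⟩
  · filter_upwards [hmk] with θ hθ
    rw [hθ]
    exact hG.monotone.deriv_nonneg
  · filter_upwards [hmk] with θ hθ hneg
    rw [hθ]
    have : G =ᶠ[𝓝 θ] fun _ => 0 := by
      filter_upwards [Iio_mem_nhds hneg] with t ht using hG.eq_zero t (le_of_lt ht)
    rw [this.deriv_eq, deriv_const]
  · have : IsFiniteMeasure ((volume : Measure ℝ).restrict K) := ⟨by simpa using hK.measure_lt_top⟩
    refine MemLp.of_bound (AEEqFun.aestronglyMeasurable _).restrict ν.toNNReal ?_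
    filter_upwards [ae_restrict_of_ae hmk] with θ hθ
    rw [hθ]
    exact norm_deriv_le_of_lipschitz hlip
  · funext θ
    have h1 : ∫ s in (0 : ℝ)..θ, AEEqFun.mk (deriv G) hm s = ∫ s in (0 : ℝ)..θ, deriv G s :=
      intervalIntegral.integral_congr_ae (by filter_upwards [hmk] with s hs _ using hs)
    refine h1.trans ?_
    rw [(hlip.lipschitzOnWith.absolutelyContinuousOnInterval).integral_deriv_eq_sub,
      hG.eq_zero 0 le_rfl, sub_zero]

theorem RateUpTo.primitive_of_le {p : ℝ≥0∞} {T : ℝ} (hp : 1 ≤ p) (f : RateUpTo p T)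
    {θ : ℝ} (hθ : T ≤ θ) : f.1.primitive θ = f.1.primitive T := by
  rw [← sub_eq_zero]
  refine (intervalIntegral.integral_interval_sub_left (f.1.intervalIntegrable hp _ _)
    (f.1.intervalIntegrable hp _ _)).trans (intervalIntegral.integral_zero_ae ?_)
  filter_upwards [f.2] with s hs hmem
  rw [uIoc_of_le hθ] at hmem
  exact hs fun h => absurd h.2 (not_le.2 hmem.1)

theorem Rate.truncate_ae_eq {p : ℝ≥0∞} (f : Rate p) (T : ℝ) :
    (f.truncate T).1 =ᵐ[volume] (Icc (0 : ℝ) T).indicator f :=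
  AEEqFun.coeFn_mk _ _

theorem Rate.primitive_truncate {p : ℝ≥0∞} (f : Rate p) {T θ : ℝ} (hθ : θ ≤ T) :
    (f.truncate T).1.primitive θ = f.primitive θ := by
  rcases le_total θ 0 with h0 | h0
  · rw [Rate.primitive_of_nonpos _ h0, Rate.primitive_of_nonpos _ h0]
  · refine intervalIntegral.integral_congr_ae ?_
    filter_upwards [f.truncate_ae_eq T] with s hs hmem
    rw [uIoc_of_le h0] at hmem
    rw [hs, indicator_of_mem (show s ∈ Icc 0 T from ⟨hmem.1.le, hmem.2.trans hθ⟩)]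

theorem travelTime_eq {p : ℝ≥0∞} (hp : 1 ≤ p) {E I : Type*} [Fintype I] (ν c₀ : E → ℝ)
    (f : EdgeFlow p E I) (e : E) (θ : ℝ) :
    travelTime ν c₀ f e θ = c₀ e +
      (∑ i, (f.1 (e, i)).primitive θ - ∑ i, (f.2 (e, i)).primitive θ) / ν e := by
  have hsum : ∀ (g : RateVec p E I) (e : E) (θ : ℝ),
      ∫ s in (0 : ℝ)..θ, ∑ i, g (e, i) s = ∑ i, (g (e, i)).primitive θ := fun g e θ =>
    intervalIntegral.integral_finsetSum fun i _ => (g (e, i)).intervalIntegrable hp _ _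
  simp only [travelTime, edgeVolume, hsum]

theorem respectsTravelTimes_iff {p : ℝ≥0∞} (hp : 1 ≤ p) {E I : Type*} [Fintype I] {ν c₀ : E → ℝ}
    {f : EdgeFlow p E I} :
    RespectsTravelTimes ν c₀ f ↔ ∀ e, IsCumulativeLoading (ν e) (c₀ e)
      (fun i => (f.1 (e, i)).primitive) (fun i => (f.2 (e, i)).primitive) := by
  have hτ : ∀ e θ, exitTime ν c₀ f e θ = cumulativeExitTime (ν e) (c₀ e)
      (fun t => ∑ j, (f.1 (e, j)).primitive t) (fun t => ∑ j, (f.2 (e, j)).primitive t) θ := by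
    intro e θ
    rw [exitTime, travelTime_eq hp, cumulativeExitTime]
  constructor
  · exact fun h e => ⟨fun i => Rate.isCumulative hp _, fun i => Rate.isCumulative hp _,
      fun i θ => by rw [← hτ]; exact h e i θ⟩
  · intro h e i θ
    rw [hτ]
    exact (h e).eq_outflow i θ

/-! ### Weak convergence -/

theorem weaklyConverges_iff {X : Type*} [NormedAddCommGroup X] [NormedSpace ℝ X] {x : ℕ → X}
    {y : X} : WeaklyConverges x y ↔ ∀ l : X →L[ℝ] ℝ, Tendsto (fun n => l (x n)) atTop (𝓝 (l y)) := by
  refine WeakBilin.tendsto_iff_forall_eval_tendsto (topDualPairing ℝ X).flip fun a b hab => ?_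
  exact (SeparatingDual.eq_iff_forall_dual_eq (R := ℝ)).2 fun g => LinearMap.congr_fun hab g

theorem WeaklyConverges.map {X Y : Type*} [NormedAddCommGroup X] [NormedSpace ℝ X]
    [NormedAddCommGroup Y] [NormedSpace ℝ Y] {x : ℕ → X} {y : X} (h : WeaklyConverges x y)
    (L : X →L[ℝ] Y) : WeaklyConverges (fun n => L (x n)) (L y) :=
  weaklyConverges_iff.2 fun l => weaklyConverges_iff.1 h (l.comp L)

theorem weaklyConverges_pi {ι : Type*} [Fintype ι] {X : Type*} [NormedAddCommGroup X]
    [NormedSpace ℝ X] {x : ℕ → ι → X} {y : ι → X}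
    (h : ∀ a, WeaklyConverges (fun n => x n a) (y a)) : WeaklyConverges x y := by
  classical
  refine weaklyConverges_iff.2 fun l => ?_
  have e : ∀ z : ι → X, l z = ∑ a, l (ContinuousLinearMap.single ℝ (fun _ => X) a (z a)) := by
    intro z
    conv_lhs => rw [← Finset.univ_sum_single z, map_sum]
    rfl
  rw [e y]
  refine Tendsto.congr (fun n => (e (x n)).symm) ?_
  exact tendsto_finsetSum _ fun a _ => weaklyConverges_iff.1 (h a)
    (l.comp (ContinuousLinearMap.single ℝ (fun _ => X) a))

/-- Integration over a set of finite measure is a functional on `L^p`, the pairing with an indicator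
function. -/
theorem exists_clm_eq_setIntegral {α : Type*} [MeasurableSpace α] {μ : Measure α} {p : ℝ≥0∞}
    [Fact (1 ≤ p)] {S : Set α} (hS : MeasurableSet S) (hμS : μ S ≠ ∞) :
    ∃ L : Lp ℝ p μ →L[ℝ] ℝ, ∀ u : Lp ℝ p μ, L u = ∫ x in S, u x ∂μ := by
  have hq : Fact (1 ≤ ENNReal.conjExponent p) :=
    ⟨ENNReal.HolderConjugate.one_le (ENNReal.conjExponent p) p⟩
  refine ⟨((ContinuousLinearMap.mul ℝ ℝ).lpPairing μ p (ENNReal.conjExponent p)).flip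
    (indicatorConstLp (ENNReal.conjExponent p) hS hμS 1), fun u => ?_⟩
  rw [ContinuousLinearMap.flip_apply, ContinuousLinearMap.lpPairing_eq_integral,
    ← integral_indicator hS]
  refine integral_congr_ae ?_
  filter_upwards [indicatorConstLp_coeFn (p := ENNReal.conjExponent p)
    (hs := hS) (hμs := hμS) (c := (1 : ℝ))] with x hx
  rw [hx]
  by_cases hm : x ∈ S <;> simp [hm]

theorem WeaklyConverges.tendsto_primitive {p : ℝ≥0∞} [Fact (1 ≤ p)] {T : ℝ}
    {f : ℕ → RateUpTo p T} {g : RateUpTo p T}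
    (h : WeaklyConverges (fun n => (f n).toLp) g.toLp) (θ : ℝ) :
    Tendsto (fun n => (f n).1.primitive θ) atTop (𝓝 (g.1.primitive θ)) := by
  rcases le_total θ 0 with h0 | h0
  · simp only [Rate.primitive_of_nonpos _ h0]
    exact tendsto_const_nhds
  · obtain ⟨L, hL⟩ := exists_clm_eq_setIntegral (μ := (volume : Measure ℝ)) (p := p)
      (measurableSet_Ioc (a := 0) (b := θ)) measure_Ioc_lt_top.ne
    have hL' : ∀ u : RateUpTo p T, L u.toLp = u.1.primitive θ := fun u =>
      (hL _).trans (intervalIntegral.integral_of_le h0).symm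
    simpa only [hL'] using weaklyConverges_iff.1 h L

/-- Pólya's observation: monotone functions that converge pointwise to a continuous limit converge
locally uniformly. -/
theorem tendstoLocallyUniformly_of_monotone {Fs : ℕ → ℝ → ℝ} {F : ℝ → ℝ}
    (hmono : ∀ n, Monotone (Fs n)) (hF : Continuous F)
    (h : ∀ t, Tendsto (fun n => Fs n t) atTop (𝓝 (F t))) :
    TendstoLocallyUniformly Fs F atTop := by
  rw [Metric.tendstoLocallyUniformly_iff]
  intro ε hε x
  obtain ⟨δ, hδ, hFδ⟩ := Metric.continuous_iff.1 hF x (ε / 4) (by positivity)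
  have hclose : ∀ y, |y - x| < δ → |F y - F x| < ε / 4 := fun y hy => hFδ y hy
  refine ⟨Ioo (x - δ / 2) (x + δ / 2), Ioo_mem_nhds (by linarith) (by linarith), ?_⟩
  filter_upwards [Metric.tendsto_nhds.1 (h (x - δ / 2)) (ε / 4) (by positivity),
    Metric.tendsto_nhds.1 (h (x + δ / 2)) (ε / 4) (by positivity)] with n h1 h2 y hy
  rw [Real.dist_eq] at h1 h2 ⊢
  have h3 := abs_lt.1 (hclose (x - δ / 2) (by rw [abs_lt]; constructor <;> linarith))
  have h4 := abs_lt.1 (hclose (x + δ / 2) (by rw [abs_lt]; constructor <;> linarith))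
  have h5 := abs_lt.1 (hclose y (by rw [abs_lt]; constructor <;> linarith [hy.1, hy.2]))
  have h6 := hmono n hy.1.le
  have h7 := hmono n hy.2.le
  rw [abs_lt] at h1 h2 ⊢
  constructor <;> linarith [h1.1, h1.2, h2.1, h2.2, h3.1, h3.2, h4.1, h4.2, h5.1, h5.2]

/-! ### The edge loading operator -/

theorem existsUnique_isVolumeDelayLoading {p : ℝ≥0∞} (hp : 1 ≤ p) {E I : Type*} [Fintype I]
    {ν c₀ : E → ℝ} (hν : ∀ e, 0 < ν e) (hc₀ : ∀ e, 0 < c₀ e) :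
    ∃! Φ : EdgeLoadingOperator p E I, IsVolumeDelayLoading ν c₀ Φ := by
  have hex : ∀ f : RateVec p E I, ∃ g : RateVec p E I, RespectsTravelTimes ν c₀ (f, g) := by
    intro f
    choose G hG hrate using fun e => exists_isCumulativeLoading (hν e) (hc₀ e)
      (F := fun i => (f (e, i)).primitive) fun i => Rate.isCumulative hp _
    choose g hg using fun a : E × I => exists_rate_primitive_eq (p := p)
      ((hG a.1).outflow a.2) (hrate a.1 a.2)
    refine ⟨g, (respectsTravelTimes_iff hp).2 fun e => ?_⟩
    simpa only [hg] using hG e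
  choose Φ hΦ using hex
  refine ⟨Φ, hΦ, fun Ψ hΨ => funext fun f => funext fun a => Rate.ext_of_primitive hp ?_⟩
  exact congrFun (((respectsTravelTimes_iff hp).1 (hΨ f) a.1).unique (hν a.1) (hc₀ a.1)
    ((respectsTravelTimes_iff hp).1 (hΦ f) a.1)) a.2

/-- The truncated outflow rates are bounded by the capacity. -/
theorem ae_abs_restrict_le {p : ℝ≥0∞} (hp : 1 ≤ p) {E I : Type*} [Fintype I]
    {ν c₀ : E → ℝ} (hν : ∀ e, 0 < ν e) (hc₀ : ∀ e, 0 < c₀ e) {Φ : EdgeLoadingOperator p E I}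
    (hΦ : IsVolumeDelayLoading ν c₀ Φ) {T : ℝ} (f : RateVecUpTo p T E I) (a : E × I) :
    ∀ᵐ θ, |(EdgeLoadingOperator.restrict Φ T f a).1 θ| ≤ ν a.1 := by
  filter_upwards [Rate.truncate_ae_eq (Φ (RateVecUpTo.toRateVec f) a) T,
    (Φ (RateVecUpTo.toRateVec f) a).ae_abs_le hp (hν a.1).le
      (((respectsTravelTimes_iff hp).1 (hΦ _) a.1).rate_le (hν a.1) (hc₀ a.1) a.2)] with θ h1 h2
  refine (congrArg abs h1).trans_le ?_
  exact (norm_indicator_le_norm_self (Φ (RateVecUpTo.toRateVec f) a : ℝ → ℝ) θ).trans h2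

theorem seqWeakWeakContinuous_restrict {p : ℝ≥0∞} [Fact (1 ≤ p)] (hp_top : p ≠ ∞) {E I : Type*}
    [Fintype E] [Fintype I] {ν c₀ : E → ℝ} (hν : ∀ e, 0 < ν e) (hc₀ : ∀ e, 0 < c₀ e)
    {Φ : EdgeLoadingOperator p E I} (hΦ : IsVolumeDelayLoading ν c₀ Φ) {T : ℝ} :
    SeqWeakWeakContinuous (EdgeLoadingOperator.restrict Φ T) := by
  have hp : 1 ≤ p := Fact.out
  intro g h hgh
  have hin : ∀ a θ, Tendsto (fun n => (g n a).1.primitive θ) atTop (𝓝 ((h a).1.primitive θ)) :=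
    fun a => WeaklyConverges.tendsto_primitive
      (hgh.map (ContinuousLinearMap.proj (R := ℝ) (φ := fun _ => Lp ℝ p volume) a))
  have hload := fun f => (respectsTravelTimes_iff hp).1 (hΦ f)
  have hout : ∀ a θ, Tendsto (fun n => (Φ (RateVecUpTo.toRateVec (g n)) a).primitive θ) atTop
      (𝓝 ((Φ (RateVecUpTo.toRateVec h) a).primitive θ)) := fun a =>
    IsCumulativeLoading.tendsto (hν a.1) (hc₀ a.1) (fun n => hload _ a.1) (hload _ a.1)
      (fun n i => abs_sub_le_of_increments_le ((hload _ a.1).outflow i).monotone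
        ((hload _ a.1).rate_le (hν a.1) (hc₀ a.1) i)) (fun i => hin (a.1, i)) a.2
  refine weaklyConverges_pi fun a => weaklyConverges_iff.2 fun l => ?_
  refine tendsto_apply_of_tendsto_primitive hp_top (C := ν a.1) (T := T)
    (fun n => ae_abs_restrict_le hp hν hc₀ hΦ (g n) a) (ae_abs_restrict_le hp hν hc₀ hΦ h a)
    (fun n => (EdgeLoadingOperator.restrict Φ T (g n) a).2)
    (EdgeLoadingOperator.restrict Φ T h a).2 (fun t => ?_) l
  -- Up to time `T` the truncation is not felt by the primitives; afterwards they are constant.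
  have key : ∀ t ≤ T, Tendsto (fun n => (EdgeLoadingOperator.restrict Φ T (g n) a).1.primitive t)
      atTop (𝓝 ((EdgeLoadingOperator.restrict Φ T h a).1.primitive t)) := by
    intro t ht
    unfold EdgeLoadingOperator.restrict
    simp only [Rate.primitive_truncate _ ht]
    exact hout a t
  show Tendsto (fun n => (EdgeLoadingOperator.restrict Φ T (g n) a).1.primitive t)
      atTop (𝓝 ((EdgeLoadingOperator.restrict Φ T h a).1.primitive t))
  rcases le_total t T with ht | ht
  · exact key t ht
  · simp only [RateUpTo.primitive_of_le hp _ ht]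
    exact key T le_rfl

theorem travelTimeOn_restrict_nonneg {p : ℝ≥0∞} [Fact (1 ≤ p)] {E I : Type*}
    [Fintype I] {ν c₀ : E → ℝ} (hν : ∀ e, 0 < ν e) (hc₀ : ∀ e, 0 < c₀ e)
    {Φ : EdgeLoadingOperator p E I} (hΦ : IsVolumeDelayLoading ν c₀ Φ) {T : ℝ}
    (f : RateVecUpTo p T E I) (e : E) (θ : Icc (0 : ℝ) T) :
    0 ≤ travelTimeOn ν c₀ T e (f, EdgeLoadingOperator.restrict Φ T f) θ := by
  have hp : 1 ≤ p := Fact.out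
  have h := (respectsTravelTimes_iff hp).1 (hΦ (RateVecUpTo.toRateVec f)) e
  have hle := outflow_le_inflow (hc₀ e) (IsCumulative.sum h.inflow) (IsCumulative.sum h.outflow)
    (fun θ => Finset.sum_congr rfl fun j _ => h.eq_outflow j θ) θ.1
  have hres : ∀ i, ((FlowUpTo.toFlow (f, EdgeLoadingOperator.restrict Φ T f)).2 (e, i)).primitive
      θ.1 = (Φ (RateVecUpTo.toRateVec f) (e, i)).primitive θ.1 := fun i =>
    Rate.primitive_truncate _ θ.2.2
  show 0 ≤ travelTime ν c₀ _ e θ.1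
  rw [travelTime_eq hp]
  simp only [hres]
  exact add_nonneg (hc₀ e).le (div_nonneg (sub_nonneg.2 hle) (hν e).le)

theorem seqWeakStrongContinuous_travelTimeOn {p : ℝ≥0∞} [Fact (1 ≤ p)] {E I : Type*}
    [Fintype E] [Fintype I] (ν c₀ : E → ℝ) (T : ℝ) (e : E) :
    SeqWeakStrongContinuous (fun f : FlowUpTo p T E I => travelTimeOn ν c₀ T e f) := by
  have hp : 1 ≤ p := Fact.out
  intro f g hfg
  have h1 : ∀ a, TendstoLocallyUniformly (fun n => ((f n).1 a).1.primitive) (g.1 a).1.primitive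
      atTop := fun a =>
    tendstoLocallyUniformly_of_monotone (fun n => (Rate.isCumulative hp _).monotone)
      (Rate.isCumulative hp _).continuous (WeaklyConverges.tendsto_primitive (hfg.map
        ((ContinuousLinearMap.proj (R := ℝ) (φ := fun _ => Lp ℝ p volume) a).comp
          (ContinuousLinearMap.fst ℝ _ _))))
  have h2 : ∀ a, TendstoLocallyUniformly (fun n => ((f n).2 a).1.primitive) (g.2 a).1.primitive
      atTop := fun a =>
    tendstoLocallyUniformly_of_monotone (fun n => (Rate.isCumulative hp _).monotone)
      (Rate.isCumulative hp _).continuous (WeaklyConverges.tendsto_primitive (hfg.map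
        ((ContinuousLinearMap.proj (R := ℝ) (φ := fun _ => Lp ℝ p volume) a).comp
          (ContinuousLinearMap.snd ℝ _ _))))
  -- The travel time is a linear combination of primitives, taken here in `C([0, T])`.
  let P : RateUpTo p T → C(Icc (0 : ℝ) T, ℝ) := fun u =>
    ⟨fun θ => u.1.primitive θ, (u.1.isCumulative hp).continuous.comp continuous_subtype_val⟩
  have hP : ∀ (us : ℕ → RateUpTo p T) (u : RateUpTo p T),
      TendstoLocallyUniformly (fun n => (us n).1.primitive) u.1.primitive atTop →
      Tendsto (fun n => P (us n)) atTop (𝓝 (P u)) := fun us u hu =>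
    ContinuousMap.tendsto_iff_tendstoLocallyUniformly.2
      (hu.comp (Subtype.val : Icc (0 : ℝ) T → ℝ) continuous_subtype_val)
  have heq : ∀ u : FlowUpTo p T E I, travelTimeOn ν c₀ T e u =
      ContinuousMap.const _ (c₀ e) + (ν e)⁻¹ • (∑ i, P (u.1 (e, i)) - ∑ i, P (u.2 (e, i))) := by
    intro u
    ext θ
    refine (travelTime_eq hp ν c₀ (FlowUpTo.toFlow u) e θ.1).trans ?_
    simp [P, FlowUpTo.toFlow, RateVecUpTo.toRateVec, div_eq_inv_mul]
  simp only [heq]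
  exact tendsto_const_nhds.add (((tendsto_finsetSum _ fun i _ => hP _ _ (h1 (e, i))).sub
    (tendsto_finsetSum _ fun i _ => hP _ _ (h2 (e, i)))).const_smul _)

theorem mainTheorem11 {E I : Type*} [Fintype E] [Fintype I] (p : ℝ≥0∞) [Fact (1 ≤ p)]
    (hp_one : 1 < p) (hp_top : p ≠ ⊤) (ν c₀ : E → ℝ) (hν : ∀ e, 0 < ν e) (hc₀ : ∀ e, 0 < c₀ e) :
    (∃! Φ : EdgeLoadingOperator p E I, IsVolumeDelayLoading ν c₀ Φ) ∧
    (∀ Φ : EdgeLoadingOperator p E I, IsVolumeDelayLoading ν c₀ Φ → ∀ T : ℝ, 0 ≤ T →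
      SeqWeakWeakContinuous (EdgeLoadingOperator.restrict Φ T) ∧
      ∀ (f : RateVecUpTo p T E I) (e : E) (θ : Icc (0 : ℝ) T),
        0 ≤ travelTimeOn ν c₀ T e (f, EdgeLoadingOperator.restrict Φ T f) θ) ∧
    (∀ T : ℝ, 0 ≤ T → ∀ e : E,
      SeqWeakStrongContinuous (fun f : FlowUpTo p T E I => travelTimeOn ν c₀ T e f)) :=
  ⟨existsUnique_isVolumeDelayLoading Fact.out hν hc₀,
    fun _ hΦ _ _ => ⟨seqWeakWeakContinuous_restrict hp_top hν hc₀ hΦ,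
      fun f e θ => travelTimeOn_restrict_nonneg hν hc₀ hΦ f e θ⟩,
    fun T _ e => seqWeakStrongContinuous_travelTimeOn ν c₀ T e⟩
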